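/- A homogeneous polynomial $h\in\mathbb R[x_1,\dots,x_n]$ is called hyperbolic with respect to $e\in\mathbb R^n$ if $h(e)\neq 0$ and for every $v\in\mathbb R^n$ the univariate polynomial $h(te+v)\in\mathbb R[t]$ has only real roots. Its hyperbolicity cone at $e$ is $$\Lambda_h(e)=\{v\in\mathbb R^n : \text{no zero of } h(te+v)\text{ is strictly positive}\}.$$ A spectrahedral cone is a set of the form $\{v\in\mathbb R^n : v_1B_1+\dots+v_nB_n\succeq 0\}$ with real symmetric matrices $B_1,\dots,B_n$ of the same size. A polynomial $p\in\mathbb R[x_1,\dots,x_n]$ has a definite determinantal representation (with respect to $e$) if $p=\det(x_1B_1+\dots+x_nB_n)$ for some real symmetric matrices $B_1,\dots,B_n$ of the same size with $e_1B_1+\dots+e_nB_n\succ 0$. Let $$h_4=x_1^2x_2^2+4(x_1+x_2+x_3+x_4)(x_1x_2x_3+x_1x_2x_4+x_1x_3x_4+x_2x_3x_4)\in\mathbb R[x_1,x_2,x_3,x_4]$$ be the specialized Vámos polynomial, let $e=(1,1,0,0)$, and let $$A_1=\begin{pmatrix}0&0&0&0&0&0&0&0&0\\ 0&2&4&4&2&3&0&3&0\\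 0&4&15&10&4&9&0&12&0\\ 0&4&10&15&4&12&0&7&0\\ 0&2&4&4&8&4&0&4&0\\ 0&3&9&12&4&12&0&8&0\\ 0&0&0&0&0&0&0&0&0\\ 0&3&12&7&4&8&0&12&0\\ 0&0&0&0&0&0&0&0&0\end{pmatrix},$$ $$A_2=\begin{pmatrix}2&0&4&4&0&0&3&0&3\\ 0&0&0&0&0&0&0&0&0\\ 4&0&15&12&4&0&9&0&12\\ 4&0&12&15&4&0&12&0&9\\ 0&0&4&4&8&0&4&0&4\\ 0&0&0&0&0&0&0&0&0\\ 3&0&9&12&4&0&12&0&8\\ 0&0&0&0&0&0&0&0&0\\ 3&0&12&9&4&0&8&0&12\end{pmatrix},$$ $$A_3=\begin{pmatrix}5&4&5&13&0&3&4&0&0\\ 4&5&5&13&0&4&3&0&0\\ 5&5&8&16&0&4&4&0&0\\ 13&13&16&66&0&24&24&0&0\\ 0&0&0&0&0&0&0&0&0\\ 3&4&4&24&0&12&8&0&0\\ 4&3&4&24&0&8&12&0&0\\ 0&0&0&0&0&0&0&0&0\\ 0&0&0&0&0&0&0&0&0\end{pmatrix},$$ $$A_4=\begin{pmatrix}5&4&13&5&0&0&0&5&4\\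 4&5&11&5&0&0&0&4&3\\ 13&11&62&14&0&0&0&24&24\\ 5&5&14&8&0&0&0&4&4\\ 0&0&0&0&0&0&0&0&0\\ 0&0&0&0&0&0&0&0&0\\ 0&0&0&0&0&0&0&0&0\\ 5&4&24&4&0&0&0&12&8\\ 4&3&24&4&0&0&0&8&12\end{pmatrix}.$$ Then $h_4$ is hyperbolic with respect to $e$, and $$\Lambda_{h_4}(e)=\{v\in\mathbb R^4 : v_1A_1+v_2A_2+v_3A_3+v_4A_4\succeq 0\}.$$ In particular, $\Lambda_{h_4}(e)$ is a spectrahedral cone. On the other hand, for no integer $N\geq 1$ does the power $h_4^N$ have a definite determinantal representation with respect to $e$. -/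

import Mathlib

/-- `IsHyperbolic h e`: the polynomial `h` is homogeneous, does not vanish at `e`, and for every real
vector `v` all complex zeros of the univariate polynomial `t ↦ h (t e + v)` are real. -/
def IsHyperbolic {n : ℕ} (h : MvPolynomial (Fin n) ℝ) (e : Fin n → ℝ) : Prop :=
  (∃ d : ℕ, h.IsHomogeneous d) ∧ MvPolynomial.eval e h ≠ 0 ∧
    ∀ v : Fin n → ℝ, ∀ z : ℂ,
      MvPolynomial.aeval (fun i => z * (e i : ℂ) + (v i : ℂ)) h = 0 → z.im = 0

/-- The hyperbolicity cone of `h` at `e`: all `v` such that no zero of `t ↦ h (t e + v)` is strictly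
positive. -/
def hyperbolicityCone {n : ℕ} (h : MvPolynomial (Fin n) ℝ) (e : Fin n → ℝ) : Set (Fin n → ℝ) :=
  {v | ∀ t : ℝ, MvPolynomial.eval (t • e + v) h = 0 → ¬ 0 < t}

/-- The value `v₁ A₁ + ⋯ + vₙ Aₙ` of the linear matrix pencil given by `A₁, …, Aₙ`. -/
def linearPencil {n m : ℕ} (A : Fin n → Matrix (Fin m) (Fin m) ℝ) (v : Fin n → ℝ) :
    Matrix (Fin m) (Fin m) ℝ :=
  ∑ i, v i • A i

/-- The determinant of the matrix `x₁ A₁ + ⋯ + xₙ Aₙ` of linear forms, as a polynomial. -/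
noncomputable def pencilDet {n m : ℕ} (A : Fin n → Matrix (Fin m) (Fin m) ℝ) :
    MvPolynomial (Fin n) ℝ :=
  Matrix.det (∑ i, (MvPolynomial.X i : MvPolynomial (Fin n) ℝ) • (A i).map MvPolynomial.C)

/-- A spectrahedral cone: the set where a linear pencil of real symmetric matrices is positive
semidefinite. -/
def IsSpectrahedralCone {n : ℕ} (S : Set (Fin n → ℝ)) : Prop :=
  ∃ (m : ℕ) (A : Fin n → Matrix (Fin m) (Fin m) ℝ),
    (∀ i, (A i).IsSymm) ∧ S = {v | (linearPencil A v).PosSemidef}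

/-- `p` has a determinantal representation `p = det (x₁ A₁ + ⋯ + xₙ Aₙ)` with real symmetric
matrices of some size that is definite at `e`, that is, `e₁ A₁ + ⋯ + eₙ Aₙ` is positive definite. -/
def HasDefiniteDetRep {n : ℕ} (p : MvPolynomial (Fin n) ℝ) (e : Fin n → ℝ) : Prop :=
  ∃ (m : ℕ) (A : Fin n → Matrix (Fin m) (Fin m) ℝ),
    (∀ i, (A i).IsSymm) ∧ (linearPencil A e).PosDef ∧ p = pencilDet A

section

open MvPolynomial

/-- The specialized Vámos polynomial; the variables `x₁, …, x₄` are `X 0, …, X 3`. -/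
noncomputable def vamosPoly : MvPolynomial (Fin 4) ℝ :=
  X 0 ^ 2 * X 1 ^ 2 + 4 * (X 0 + X 1 + X 2 + X 3) *
    (X 0 * X 1 * X 2 + X 0 * X 1 * X 3 + X 0 * X 2 * X 3 + X 1 * X 2 * X 3)

end

/-- The direction `e = (1, 1, 0, 0)`. -/
def vamosDir : Fin 4 → ℝ := ![1, 1, 0, 0]

/-- The matrix `A_1`. -/
def vamosA1 : Matrix (Fin 9) (Fin 9) ℝ :=
  !![0, 0, 0, 0, 0, 0, 0, 0, 0;
     0, 2, 4, 4, 2, 3, 0, 3, 0;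
     0, 4, 15, 10, 4, 9, 0, 12, 0;
     0, 4, 10, 15, 4, 12, 0, 7, 0;
     0, 2, 4, 4, 8, 4, 0, 4, 0;
     0, 3, 9, 12, 4, 12, 0, 8, 0;
     0, 0, 0, 0, 0, 0, 0, 0, 0;
     0, 3, 12, 7, 4, 8, 0, 12, 0;
     0, 0, 0, 0, 0, 0, 0, 0, 0]

/-- The matrix `A_2`. -/
def vamosA2 : Matrix (Fin 9) (Fin 9) ℝ :=
  !![2, 0, 4, 4, 0, 0, 3, 0, 3;
     0, 0, 0, 0, 0, 0, 0, 0, 0;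
     4, 0, 15, 12, 4, 0, 9, 0, 12;
     4, 0, 12, 15, 4, 0, 12, 0, 9;
     0, 0, 4, 4, 8, 0, 4, 0, 4;
     0, 0, 0, 0, 0, 0, 0, 0, 0;
     3, 0, 9, 12, 4, 0, 12, 0, 8;
     0, 0, 0, 0, 0, 0, 0, 0, 0;
     3, 0, 12, 9, 4, 0, 8, 0, 12]

/-- The matrix `A_3`. -/
def vamosA3 : Matrix (Fin 9) (Fin 9) ℝ :=
  !![5, 4, 5, 13, 0, 3, 4, 0, 0;
     4, 5, 5, 13, 0, 4, 3, 0, 0;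
     5, 5, 8, 16, 0, 4, 4, 0, 0;
     13, 13, 16, 66, 0, 24, 24, 0, 0;
     0, 0, 0, 0, 0, 0, 0, 0, 0;
     3, 4, 4, 24, 0, 12, 8, 0, 0;
     4, 3, 4, 24, 0, 8, 12, 0, 0;
     0, 0, 0, 0, 0, 0, 0, 0, 0;
     0, 0, 0, 0, 0, 0, 0, 0, 0]

/-- The matrix `A_4`. -/
def vamosA4 : Matrix (Fin 9) (Fin 9) ℝ :=
  !![5, 4, 13, 5, 0, 0, 0, 5, 4;
     4, 5, 11, 5, 0, 0, 0, 4, 3;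
     13, 11, 62, 14, 0, 0, 0, 24, 24;
     5, 5, 14, 8, 0, 0, 0, 4, 4;
     0, 0, 0, 0, 0, 0, 0, 0, 0;
     0, 0, 0, 0, 0, 0, 0, 0, 0;
     0, 0, 0, 0, 0, 0, 0, 0, 0;
     5, 4, 24, 4, 0, 0, 0, 12, 8;
     4, 3, 24, 4, 0, 0, 0, 8, 12]

/-!
The pencil `A(x) = x₁ A₁ + ⋯ + x₄ A₄` comes with nine cubic forms `φ(x)` (`vamosKernel`) and a
constant vector `c` (`vamosCovec`) such that `A(x) φ(x) = h₄(x) c`; moreover `A(e)` is positive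
definite.

*Hyperbolicity.* If `h₄(z e + v) = 0`, then `φ(z e + v)` lies in the kernel of `A(v) + z A(e)`. For
non-real `z` this vector is nonzero, which is impossible for a real symmetric pencil with `A(e)`
positive definite.

*The cone.* If `A(v)` is positive semidefinite, then `A(t e + v)` is positive definite for `t > 0`,
and the kernel vector `φ` shows that `h₄(t e + v) ≠ 0`. Conversely, let `v` lie in the hyperbolicity
cone. Since `A(x) φ(x) = h₄(x) c`, the vector `φ(x)` is `A(x)`-orthogonal to the hyperplane
`cᵀ w = 0`, and the form takes at `φ(x)` the value `h₄(x) cᵀ φ(x)`, which is positive for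
`x = e + s v` with `s > 0`. So it suffices that `A(v)` be positive semidefinite on the hyperplane
`cᵀ w = 0`. On this hyperplane there is room: the hyperbolicity cone is contained in the conical
hull of ten rays (the unit vectors, `(-1, 1, 1, 1)` and its permutations, `(3, 3, -1, 0)` and
`(3, 3, 0, -1)`), and for each of these the restricted form is a sum of squares
(`nonneg_of_vamosEval_pos`).

*No determinantal representation.* Suppose that `h₄ ^ N = det (x₁ B₁ + ⋯ + x₄ B₄)`, definite at `e`.
The `Bᵢ` are positive semidefinite, so that the kernel of a sum of some of them is the intersection
of their kernels `Kᵢ`, and its dimension is the order of vanishing at `t = 0` of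
`h₄(t e + δ) ^ N`, where `δ` is the indicator vector of the set of indices
(`Matrix.PosDef.finrank_ker_eq`). The resulting dimensions violate the
Ingleton inequality: `K₁` and `K₂` are independent of dimension `2 N` and are both contained in
`K₃ + K₄`, which has dimension `3 N` (`eq_zero_of_finrank_inf`).
-/

/-! ### The kernel of the pencil along the hypersurface -/

/-- The vector `φ(x)` of nine cubic forms, which the pencil `A(x)` annihilates on the hypersurface
`h₄ = 0`. -/
def vamosKernel {R : Type*} [CommRing R] (x : Fin 4 → R) : Fin 9 → R :=
  ![x 0 ^ 2 * x 1, x 0 * x 1 ^ 2, x 0 * x 1 * x 2, x 0 * x 1 * x 3,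
    x 2 * x 3 * (x 0 + x 1 + x 2 + x 3),
    x 1 * x 3 * (x 1 + x 2 + x 3), x 0 * x 3 * (x 0 + x 2 + x 3),
    x 1 * x 2 * (x 1 + x 2 + x 3), x 0 * x 2 * (x 0 + x 2 + x 3)]

/-- The constant vector `c` with `A(x) φ(x) = h₄(x) c`. -/
def vamosCovec {R : Type*} [CommRing R] : Fin 9 → R := ![2, 2, 8, 8, 2, 3, 3, 3, 3]

/-- The value of `h₄` at `(a, b, c, d)`. -/
def vamosEval {R : Type*} [CommRing R] (a b c d : R) : R :=
  a ^ 2 * b ^ 2 + 4 * (a + b + c + d) * (a * b * c + a * b * d + a * c * d + b * c * d)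

theorem eval_vamosPoly (v : Fin 4 → ℝ) :
    MvPolynomial.eval v vamosPoly = vamosEval (v 0) (v 1) (v 2) (v 3) := by
  simp [vamosPoly, vamosEval]

theorem aeval_vamosPoly (x : Fin 4 → ℂ) :
    MvPolynomial.aeval x vamosPoly = vamosEval (x 0) (x 1) (x 2) (x 3) := by
  simp [vamosPoly, vamosEval, map_ofNat]

open Matrix in
theorem vamosA1_map_mulVec {R : Type*} [CommRing R] (f : ℝ →+* R) (w : Fin 9 → R) :
    vamosA1.map f *ᵥ w = ![
      0,
      2 * w 1 + 4 * w 2 + 4 * w 3 + 2 * w 4 + 3 * w 5 + 3 * w 7,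
      4 * w 1 + 15 * w 2 + 10 * w 3 + 4 * w 4 + 9 * w 5 + 12 * w 7,
      4 * w 1 + 10 * w 2 + 15 * w 3 + 4 * w 4 + 12 * w 5 + 7 * w 7,
      2 * w 1 + 4 * w 2 + 4 * w 3 + 8 * w 4 + 4 * w 5 + 4 * w 7,
      3 * w 1 + 9 * w 2 + 12 * w 3 + 4 * w 4 + 12 * w 5 + 8 * w 7,
      0,
      3 * w 1 + 12 * w 2 + 7 * w 3 + 4 * w 4 + 8 * w 5 + 12 * w 7,
      0] := by
  ext i
  fin_cases i <;>
    simp [vamosA1, Matrix.mulVec, dotProduct, Fin.sum_univ_succ, map_ofNat] <;> ring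

theorem vamosA1_isSymm : vamosA1.IsSymm := by
  ext i j
  fin_cases i <;> fin_cases j <;> rfl

open Matrix in
theorem vamosA2_map_mulVec {R : Type*} [CommRing R] (f : ℝ →+* R) (w : Fin 9 → R) :
    vamosA2.map f *ᵥ w = ![
      2 * w 0 + 4 * w 2 + 4 * w 3 + 3 * w 6 + 3 * w 8,
      0,
      4 * w 0 + 15 * w 2 + 12 * w 3 + 4 * w 4 + 9 * w 6 + 12 * w 8,
      4 * w 0 + 12 * w 2 + 15 * w 3 + 4 * w 4 + 12 * w 6 + 9 * w 8,
      4 * w 2 + 4 * w 3 + 8 * w 4 + 4 * w 6 + 4 * w 8,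
      0,
      3 * w 0 + 9 * w 2 + 12 * w 3 + 4 * w 4 + 12 * w 6 + 8 * w 8,
      0,
      3 * w 0 + 12 * w 2 + 9 * w 3 + 4 * w 4 + 8 * w 6 + 12 * w 8] := by
  ext i
  fin_cases i <;>
    simp [vamosA2, Matrix.mulVec, dotProduct, Fin.sum_univ_succ, map_ofNat] <;> ring

theorem vamosA2_isSymm : vamosA2.IsSymm := by
  ext i j
  fin_cases i <;> fin_cases j <;> rfl

open Matrix in
theorem vamosA3_map_mulVec {R : Type*} [CommRing R] (f : ℝ →+* R) (w : Fin 9 → R) :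
    vamosA3.map f *ᵥ w = ![
      5 * w 0 + 4 * w 1 + 5 * w 2 + 13 * w 3 + 3 * w 5 + 4 * w 6,
      4 * w 0 + 5 * w 1 + 5 * w 2 + 13 * w 3 + 4 * w 5 + 3 * w 6,
      5 * w 0 + 5 * w 1 + 8 * w 2 + 16 * w 3 + 4 * w 5 + 4 * w 6,
      13 * w 0 + 13 * w 1 + 16 * w 2 + 66 * w 3 + 24 * w 5 + 24 * w 6,
      0,
      3 * w 0 + 4 * w 1 + 4 * w 2 + 24 * w 3 + 12 * w 5 + 8 * w 6,
      4 * w 0 + 3 * w 1 + 4 * w 2 + 24 * w 3 + 8 * w 5 + 12 * w 6,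
      0,
      0] := by
  ext i
  fin_cases i <;>
    simp [vamosA3, Matrix.mulVec, dotProduct, Fin.sum_univ_succ, map_ofNat] <;> ring

theorem vamosA3_isSymm : vamosA3.IsSymm := by
  ext i j
  fin_cases i <;> fin_cases j <;> rfl

open Matrix in
theorem vamosA4_map_mulVec {R : Type*} [CommRing R] (f : ℝ →+* R) (w : Fin 9 → R) :
    vamosA4.map f *ᵥ w = ![
      5 * w 0 + 4 * w 1 + 13 * w 2 + 5 * w 3 + 5 * w 7 + 4 * w 8,
      4 * w 0 + 5 * w 1 + 11 * w 2 + 5 * w 3 + 4 * w 7 + 3 * w 8,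
      13 * w 0 + 11 * w 1 + 62 * w 2 + 14 * w 3 + 24 * w 7 + 24 * w 8,
      5 * w 0 + 5 * w 1 + 14 * w 2 + 8 * w 3 + 4 * w 7 + 4 * w 8,
      0,
      0,
      0,
      5 * w 0 + 4 * w 1 + 24 * w 2 + 4 * w 3 + 12 * w 7 + 8 * w 8,
      4 * w 0 + 3 * w 1 + 24 * w 2 + 4 * w 3 + 8 * w 7 + 12 * w 8] := by
  ext i
  fin_cases i <;>
    simp [vamosA4, Matrix.mulVec, dotProduct, Fin.sum_univ_succ, map_ofNat] <;> ring

theorem vamosA4_isSymm : vamosA4.IsSymm := by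
  ext i j
  fin_cases i <;> fin_cases j <;> rfl

open Matrix in
/-- The identity `A(x) φ(x) = h₄(x) c`, over any commutative `ℝ`-algebra. -/
theorem pencil_mulVec_vamosKernel {R : Type*} [CommRing R] (f : ℝ →+* R) (x : Fin 4 → R) :
    x 0 • (vamosA1.map f *ᵥ vamosKernel x) + x 1 • (vamosA2.map f *ᵥ vamosKernel x)
      + x 2 • (vamosA3.map f *ᵥ vamosKernel x) + x 3 • (vamosA4.map f *ᵥ vamosKernel x)
      = vamosEval (x 0) (x 1) (x 2) (x 3) • vamosCovec := by
  rw [vamosA1_map_mulVec, vamosA2_map_mulVec, vamosA3_map_mulVec, vamosA4_map_mulVec]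
  ext i
  fin_cases i <;> simp [vamosKernel, vamosCovec, vamosEval] <;> ring

/-! ### Sum-of-squares certificates -/

open Matrix in
/-- The quadratic form `w ↦ wᵀ M w`. -/
abbrev Matrix.quad {m : ℕ} (M : Matrix (Fin m) (Fin m) ℝ) (w : Fin m → ℝ) : ℝ := w ⬝ᵥ M *ᵥ w

open Matrix in
theorem quad_vamosA1 (w : Fin 9 → ℝ) : vamosA1.quad w =
    2 * w 1 ^ 2 + 8 * w 1 * w 2 + 8 * w 1 * w 3 + 4 * w 1 * w 4 + 6 * w 1 * w 5 + 6 * w 1 * w 7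
      + 15 * w 2 ^ 2 + 20 * w 2 * w 3 + 8 * w 2 * w 4 + 18 * w 2 * w 5 + 24 * w 2 * w 7
      + 15 * w 3 ^ 2 + 8 * w 3 * w 4 + 24 * w 3 * w 5 + 14 * w 3 * w 7 + 8 * w 4 ^ 2
      + 8 * w 4 * w 5 + 8 * w 4 * w 7 + 12 * w 5 ^ 2 + 16 * w 5 * w 7 + 12 * w 7 ^ 2 := by
  have h := vamosA1_map_mulVec (RingHom.id ℝ) w
  rw [show vamosA1.map (RingHom.id ℝ) = vamosA1 from Matrix.map_id _] at h
  rw [Matrix.quad, h]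
  simp [dotProduct, Fin.sum_univ_succ]
  ring

open Matrix in
theorem quad_vamosA2 (w : Fin 9 → ℝ) : vamosA2.quad w =
    2 * w 0 ^ 2 + 8 * w 0 * w 2 + 8 * w 0 * w 3 + 6 * w 0 * w 6 + 6 * w 0 * w 8 + 15 * w 2 ^ 2
      + 24 * w 2 * w 3 + 8 * w 2 * w 4 + 18 * w 2 * w 6 + 24 * w 2 * w 8 + 15 * w 3 ^ 2
      + 8 * w 3 * w 4 + 24 * w 3 * w 6 + 18 * w 3 * w 8 + 8 * w 4 ^ 2 + 8 * w 4 * w 6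
      + 8 * w 4 * w 8 + 12 * w 6 ^ 2 + 16 * w 6 * w 8 + 12 * w 8 ^ 2 := by
  have h := vamosA2_map_mulVec (RingHom.id ℝ) w
  rw [show vamosA2.map (RingHom.id ℝ) = vamosA2 from Matrix.map_id _] at h
  rw [Matrix.quad, h]
  simp [dotProduct, Fin.sum_univ_succ]
  ring

open Matrix in
theorem quad_vamosA3 (w : Fin 9 → ℝ) : vamosA3.quad w =
    5 * w 0 ^ 2 + 8 * w 0 * w 1 + 10 * w 0 * w 2 + 26 * w 0 * w 3 + 6 * w 0 * w 5
      + 8 * w 0 * w 6 + 5 * w 1 ^ 2 + 10 * w 1 * w 2 + 26 * w 1 * w 3 + 8 * w 1 * w 5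
      + 6 * w 1 * w 6 + 8 * w 2 ^ 2 + 32 * w 2 * w 3 + 8 * w 2 * w 5 + 8 * w 2 * w 6
      + 66 * w 3 ^ 2 + 48 * w 3 * w 5 + 48 * w 3 * w 6 + 12 * w 5 ^ 2 + 16 * w 5 * w 6
      + 12 * w 6 ^ 2 := by
  have h := vamosA3_map_mulVec (RingHom.id ℝ) w
  rw [show vamosA3.map (RingHom.id ℝ) = vamosA3 from Matrix.map_id _] at h
  rw [Matrix.quad, h]
  simp [dotProduct, Fin.sum_univ_succ]
  ring

open Matrix in
theorem quad_vamosA4 (w : Fin 9 → ℝ) : vamosA4.quad w =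
    5 * w 0 ^ 2 + 8 * w 0 * w 1 + 26 * w 0 * w 2 + 10 * w 0 * w 3 + 10 * w 0 * w 7
      + 8 * w 0 * w 8 + 5 * w 1 ^ 2 + 22 * w 1 * w 2 + 10 * w 1 * w 3 + 8 * w 1 * w 7
      + 6 * w 1 * w 8 + 62 * w 2 ^ 2 + 28 * w 2 * w 3 + 48 * w 2 * w 7 + 48 * w 2 * w 8
      + 8 * w 3 ^ 2 + 8 * w 3 * w 7 + 8 * w 3 * w 8 + 12 * w 7 ^ 2 + 16 * w 7 * w 8
      + 12 * w 8 ^ 2 := by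
  have h := vamosA4_map_mulVec (RingHom.id ℝ) w
  rw [show vamosA4.map (RingHom.id ℝ) = vamosA4 from Matrix.map_id _] at h
  rw [Matrix.quad, h]
  simp [dotProduct, Fin.sum_univ_succ]
  ring

/-- The sums of squares in this lemma and in the lemmas below come from completing the square
(an `L D Lᵀ` decomposition of the matrix, in a suitable order of the variables). -/
theorem quad_vamosA1_nonneg (w : Fin 9 → ℝ) : 0 ≤ vamosA1.quad w := by
  have h : vamosA1.quad w =
      1 / 2 * (2 * w 1 + 4 * w 2 + 4 * w 3 + 2 * w 4 + 3 * w 5 + 3 * w 7) ^ 2 +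
      1 / 6 * (6 * w 4 + w 5 + w 7) ^ 2 +
      1 / 7 * (2 * w 2 + 7 * w 3 + 6 * w 5 + w 7) ^ 2 +
      1 / 315 * (45 * w 2 + 9 * w 5 + 40 * w 7) ^ 2 +
      1 / 171 * (12 * w 5 + 19 * w 7) ^ 2 +
      311 / 285 * (w 5) ^ 2 := by
    rw [quad_vamosA1]
    ring
  rw [h]
  positivity

theorem quad_vamosA2_nonneg (w : Fin 9 → ℝ) : 0 ≤ vamosA2.quad w := by
  have h : vamosA2.quad w =
      2 * (w 2 + w 3 + 2 * w 4 + w 6 + w 8) ^ 2 +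
      1 / 2 * (2 * w 0 + 4 * w 2 + 4 * w 3 + 3 * w 6 + 3 * w 8) ^ 2 +
      1 / 5 * (2 * w 2 + 5 * w 3 + 4 * w 6 + w 8) ^ 2 +
      3 / 35 * (7 * w 2 - w 6 + 6 * w 8) ^ 2 +
      1 / 434 * (17 * w 6 + 31 * w 8) ^ 2 +
      48 / 31 * (w 6) ^ 2 := by
    rw [quad_vamosA2]
    ring
  rw [h]
  positivity

theorem quad_vamosA3_nonneg (w : Fin 9 → ℝ) : 0 ≤ vamosA3.quad w := by
  have h : vamosA3.quad w =
      1 / 5 * (4 * w 0 + 5 * w 1 + 5 * w 2 + 13 * w 3 + 4 * w 5 + 3 * w 6) ^ 2 +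
      1 / 220 * (-w 0 + 68 * w 3 + 44 * w 5 + 28 * w 6) ^ 2 +
      1 / 3 * (w 0 + 3 * w 2 + 3 * w 3 + w 6) ^ 2 +
      1 / 110 * (7 * w 0 + 30 * w 3 + 24 * w 6) ^ 2 +
      1 / 60 * (-w 0 + 8 * w 6) ^ 2 +
      (w 0) ^ 2 := by
    rw [quad_vamosA3]
    ring
  rw [h]
  positivity

theorem quad_vamosA4_nonneg (w : Fin 9 → ℝ) : 0 ≤ vamosA4.quad w := by
  have h : vamosA4.quad w =
      1 / 5 * (5 * w 0 + 4 * w 1 + 13 * w 2 + 5 * w 3 + 5 * w 7 + 4 * w 8) ^ 2 +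
      1 / 3 * (w 1 + w 2 + 3 * w 3 - w 7) ^ 2 +
      1 / 220 * (-w 1 + 68 * w 2 + 20 * w 7 + 44 * w 8) ^ 2 +
      1 / 1320 * (7 * w 1 + 85 * w 2 + 80 * w 7) ^ 2 +
      1 / 88 * (w 1 + 11 * w 2) ^ 2 +
      311 / 220 * (w 1) ^ 2 := by
    rw [quad_vamosA4]
    ring
  rw [h]
  positivity

/-- The matrix `A(e) = A₁ + A₂` is positive definite: even `A(e) - 1/2` is a sum of squares. -/
theorem half_sum_sq_le_quad_vamosDir (w : Fin 9 → ℝ) :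
    1 / 2 * ∑ i, w i ^ 2 ≤ vamosA1.quad w + vamosA2.quad w := by
  have h : vamosA1.quad w + vamosA2.quad w = 1 / 2 * ∑ i, w i ^ 2 +
      (1 / 6 * (3 * w 0 + 8 * w 2 + 8 * w 3 + 6 * w 6 + 6 * w 8) ^ 2 +
      1 / 6 * (3 * w 1 + 8 * w 2 + 8 * w 3 + 4 * w 4 + 6 * w 5 + 6 * w 7) ^ 2 +
      1 / 22 * (2 * w 2 + 8 * w 3 + 8 * w 4 + 11 * w 6 + 4 * w 8) ^ 2 +
      1 / 22 * (2 * w 2 + 8 * w 3 + 11 * w 5 + 4 * w 7) ^ 2 +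
      1 / 2310 * (80 * w 2 - 54 * w 3 + 105 * w 7) ^ 2 +
      1 / 2310 * (80 * w 2 - 10 * w 3 + 56 * w 4 + 105 * w 8) ^ 2 +
      1 / 5110 * (100 * w 2 + 73 * w 3) ^ 2 +
      257 / 30 * (w 4) ^ 2 +
      935 / 3066 * (w 2) ^ 2) := by
    rw [quad_vamosA1, quad_vamosA2]
    simp [Fin.sum_univ_succ]
    ring
  rw [h]
  exact le_add_of_nonneg_right (by positivity)

theorem vamosCovec_dotProduct (w : Fin 9 → ℝ) : vamosCovec ⬝ᵥ w =
    2 * w 0 + 2 * w 1 + 8 * w 2 + 8 * w 3 + 2 * w 4 + 3 * w 5 + 3 * w 6 + 3 * w 7 + 3 * w 8 := by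
  simp [vamosCovec, dotProduct, Fin.sum_univ_succ]
  ring

/-- The matrix `A(-1, 1, 1, 1)` is not positive semidefinite, but it is so on the hyperplane
`cᵀ w = 0`. The same holds for the rays of the following lemmas; on that hyperplane `w 0` is
eliminated. -/
theorem quad_neg_pos_pos_pos_nonneg {w : Fin 9 → ℝ} (hw : vamosCovec ⬝ᵥ w = 0) :
    0 ≤ -vamosA1.quad w + vamosA2.quad w + vamosA3.quad w + vamosA4.quad w := by
  rw [vamosCovec_dotProduct] at hw
  have h0 : w 0 = -(2 * w 1 + 8 * w 2 + 8 * w 3 + 2 * w 4 + 3 * w 5 + 3 * w 6 + 3 * w 7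
      + 3 * w 8) / 2 := by linarith
  have h : -vamosA1.quad w + vamosA2.quad w + vamosA3.quad w + vamosA4.quad w =
      1 / 30 * (2 * w 1 + 24 * w 2 + 47 * w 3 + 15 * w 4 + 20 * w 5
        + 30 * w 6 + 9 * w 7 + 14 * w 8) ^ 2 +
      1 / 18 * (2 * w 1 + 28 * w 2 + 5 * w 3 + 9 * w 4 + 2 * w 5 + 9 * w 7 + 16 * w 8) ^ 2 +
      1 / 90 * (11 * w 1 + 13 * w 2 + 32 * w 3 + 20 * w 5 + 4 * w 8) ^ 2 +
      1 / 120 * (2 * w 1 + 49 * w 2 - 3 * w 3 + 24 * w 7 + 24 * w 8) ^ 2 +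
      1 / 15 * (-3 * w 1 + w 2 - 6 * w 3 + 8 * w 8) ^ 2 +
      1 / 8 * (-2 * w 1 - w 2 + 3 * w 3) ^ 2 +
      7 / 6 * (w 1 - w 2) ^ 2 := by
    rw [quad_vamosA1, quad_vamosA2, quad_vamosA3, quad_vamosA4, h0]
    ring
  rw [h]
  positivity

theorem quad_pos_neg_pos_pos_nonneg {w : Fin 9 → ℝ} (hw : vamosCovec ⬝ᵥ w = 0) :
    0 ≤ vamosA1.quad w - vamosA2.quad w + vamosA3.quad w + vamosA4.quad w := by
  rw [vamosCovec_dotProduct] at hw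
  have h0 : w 0 = -(2 * w 1 + 8 * w 2 + 8 * w 3 + 2 * w 4 + 3 * w 5 + 3 * w 6 + 3 * w 7
      + 3 * w 8) / 2 := by linarith
  have h : vamosA1.quad w - vamosA2.quad w + vamosA3.quad w + vamosA4.quad w =
      (2 * w 1 + 3 * w 2 + 4 * w 3 + w 4 + 2 * w 5 + w 6 + w 7 + w 8) ^ 2 +
      2 / 7 * (16 * w 2 + 7 * w 3 + 3 * w 4 + 5 * w 5 + 3 * w 6 + 8 * w 7 + 7 * w 8) ^ 2 +
      1 / 21 * (9 * w 2 + 3 * w 4 - 2 * w 5 + 3 * w 6 + 8 * w 7) ^ 2 +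
      1 / 60 * (60 * w 3 + 8 * w 4 + 33 * w 5 + 25 * w 6 - 2 * w 7) ^ 2 +
      1 / 660 * (44 * w 4 + 39 * w 5 - 5 * w 6 + 34 * w 7) ^ 2 +
      6 / 11 * (w 5 + w 6 + 2 * w 7) ^ 2 +
      2 / 3 * (w 5 - w 7) ^ 2 := by
    rw [quad_vamosA1, quad_vamosA2, quad_vamosA3, quad_vamosA4, h0]
    ring
  rw [h]
  positivity

theorem quad_pos_pos_neg_pos_nonneg {w : Fin 9 → ℝ} (hw : vamosCovec ⬝ᵥ w = 0) :
    0 ≤ vamosA1.quad w + vamosA2.quad w - vamosA3.quad w + vamosA4.quad w := by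
  rw [vamosCovec_dotProduct] at hw
  have h0 : w 0 = -(2 * w 1 + 8 * w 2 + 8 * w 3 + 2 * w 4 + 3 * w 5 + 3 * w 6 + 3 * w 7
      + 3 * w 8) / 2 := by linarith
  have h : vamosA1.quad w + vamosA2.quad w - vamosA3.quad w + vamosA4.quad w =
      2 / 9 * (2 * w 1 + 2 * w 2 + 10 * w 3 + 9 * w 4 + 5 * w 5 + 4 * w 6 + w 7) ^ 2 +
      1 / 252 * (28 * w 1 + 46 * w 2 + 32 * w 3 + 25 * w 5 - 7 * w 6 + 41 * w 7 - 9 * w 8) ^ 2 +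
      1 / 60 * (10 * w 2 + 8 * w 3 - 5 * w 5 + 15 * w 6 - 5 * w 7 + 13 * w 8) ^ 2 +
      2 / 1113 * (53 * w 2 + 46 * w 3 + 53 * w 5 + 41 * w 7 + 5 * w 8) ^ 2 +
      1 / 4 * (4 * w 2 + 4 * w 3 - w 7 + w 8) ^ 2 +
      1 / 131228 * (-32 * w 3 + 619 * w 7 - 651 * w 8) ^ 2 +
      2592 / 3095 * (w 3 + w 8) ^ 2 := by
    rw [quad_vamosA1, quad_vamosA2, quad_vamosA3, quad_vamosA4, h0]
    ring
  rw [h]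
  positivity

theorem quad_pos_pos_pos_neg_nonneg {w : Fin 9 → ℝ} (hw : vamosCovec ⬝ᵥ w = 0) :
    0 ≤ vamosA1.quad w + vamosA2.quad w + vamosA3.quad w - vamosA4.quad w := by
  rw [vamosCovec_dotProduct] at hw
  have h0 : w 0 = -(2 * w 1 + 8 * w 2 + 8 * w 3 + 2 * w 4 + 3 * w 5 + 3 * w 6 + 3 * w 7
      + 3 * w 8) / 2 := by linarith
  have h : vamosA1.quad w + vamosA2.quad w + vamosA3.quad w - vamosA4.quad w =
      1 / 30 * (-2 * w 1 + 6 * w 2 + 4 * w 3 - 5 * w 5 + 15 * w 6 + 3 * w 7 + 7 * w 8) ^ 2 +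
      2 / 9 * (2 * w 1 + 10 * w 2 + 2 * w 3 + 9 * w 4 + 2 * w 5 + 6 * w 7 + 4 * w 8) ^ 2 +
      1 / 90 * (13 * w 1 + 35 * w 2 + 40 * w 3 + 40 * w 5 + 30 * w 7 + 2 * w 8) ^ 2 +
      1 / 120 * (8 * w 1 + 16 * w 2 + 24 * w 3 + 3 * w 7 - 3 * w 8) ^ 2 +
      1 / 510 * (17 * w 1 - 5 * w 2 - 12 * w 8) ^ 2 +
      40 / 51 * (w 2 - w 8) ^ 2 +
      9 / 8 * (w 7 - w 8) ^ 2 := by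
    rw [quad_vamosA1, quad_vamosA2, quad_vamosA3, quad_vamosA4, h0]
    ring
  rw [h]
  positivity

theorem quad_three_three_neg_zero_nonneg {w : Fin 9 → ℝ} (hw : vamosCovec ⬝ᵥ w = 0) :
    0 ≤ 3 * vamosA1.quad w + 3 * vamosA2.quad w - vamosA3.quad w := by
  rw [vamosCovec_dotProduct] at hw
  have h0 : w 0 = -(2 * w 1 + 8 * w 2 + 8 * w 3 + 2 * w 4 + 3 * w 5 + 3 * w 6 + 3 * w 7
      + 3 * w 8) / 2 := by linarith
  have h : 3 * vamosA1.quad w + 3 * vamosA2.quad w - vamosA3.quad w =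
      1 / 20 * (-2 * w 1 - 6 * w 2 - 2 * w 3 + 6 * w 4 - 9 * w 5
        + 7 * w 6 - 15 * w 7 + 15 * w 8) ^ 2 +
      1 / 220 * (w 1 + 3 * w 2 + w 3 + 32 * w 4 - 28 * w 5 + 44 * w 6) ^ 2 +
      1 / 3 * (5 * w 1 + 9 * w 2 + 9 * w 3 + 6 * w 4 + 8 * w 5 + 9 * w 7) ^ 2 +
      1 / 25476 * (193 * w 1 + 579 * w 2 + 633 * w 3 + 192 * w 4 + 184 * w 5) ^ 2 +
      4 / 2895 * (26 * w 3 + 71 * w 4 + 60 * w 5) ^ 2 +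
      62 / 15 * (w 3 + w 4) ^ 2 +
      18 * (w 4) ^ 2 := by
    rw [quad_vamosA1, quad_vamosA2, quad_vamosA3, h0]
    ring
  rw [h]
  positivity

theorem quad_three_three_zero_neg_nonneg {w : Fin 9 → ℝ} (hw : vamosCovec ⬝ᵥ w = 0) :
    0 ≤ 3 * vamosA1.quad w + 3 * vamosA2.quad w - vamosA4.quad w := by
  rw [vamosCovec_dotProduct] at hw
  have h0 : w 0 = -(2 * w 1 + 8 * w 2 + 8 * w 3 + 2 * w 4 + 3 * w 5 + 3 * w 6 + 3 * w 7
      + 3 * w 8) / 2 := by linarith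
  have h : 3 * vamosA1.quad w + 3 * vamosA2.quad w - vamosA4.quad w =
      1 / 20 * (-2 * w 1 - 2 * w 2 - 6 * w 3 + 6 * w 4 - 15 * w 5
        + 15 * w 6 - 5 * w 7 + 7 * w 8) ^ 2 +
      1 / 3 * (5 * w 1 + 11 * w 2 + 9 * w 3 + 6 * w 4 + 9 * w 5 + 10 * w 7) ^ 2 +
      1 / 60 * (w 1 + 7 * w 2 + 3 * w 3 + 20 * w 7 - 12 * w 8) ^ 2 +
      1 / 580 * (29 * w 1 + 67 * w 2 + 87 * w 3 + 32 * w 4 + 8 * w 8) ^ 2 +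
      2 / 30595 * (211 * w 2 + 283 * w 4 + 49 * w 8) ^ 2 +
      2 / 136517 * (533 * w 4 + 647 * w 8) ^ 2 +
      15552 / 647 * (w 4) ^ 2 := by
    rw [quad_vamosA1, quad_vamosA2, quad_vamosA4, h0]
    ring
  rw [h]
  positivity

/-! ### Zeros of definite symmetric pencils -/

open Matrix in
/-- A zero of a real symmetric pencil `S + z E` with `E` positive definite is real. -/
theorem Matrix.PosDef.im_eq_zero_of_mulVec_eq_zero {m : ℕ} {S E : Matrix (Fin m) (Fin m) ℝ}
    (hS : S.IsSymm) (hE : E.PosDef) {z : ℂ} {u : Fin m → ℂ} (hu : u ≠ 0)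
    (h : S.map Complex.ofRealHom *ᵥ u + z • (E.map Complex.ofRealHom *ᵥ u) = 0) : z.im = 0 := by
  set p : Fin m → ℝ := fun i => (u i).re with hp
  set q : Fin m → ℝ := fun i => (u i).im with hq
  have hre : ∀ (M : Matrix (Fin m) (Fin m) ℝ) i,
      (M.map Complex.ofRealHom *ᵥ u) i = ⟨(M *ᵥ p) i, (M *ᵥ q) i⟩ := by
    intro M i
    apply Complex.ext <;> simp [Matrix.mulVec, dotProduct, hp, hq]
  have hi : ∀ i, (S *ᵥ p) i + z.re * (E *ᵥ p) i - z.im * (E *ᵥ q) i = 0 ∧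
      (S *ᵥ q) i + z.re * (E *ᵥ q) i + z.im * (E *ᵥ p) i = 0 := by
    intro i
    have hz := congrFun h i
    rw [Pi.add_apply, Pi.smul_apply, hre, hre] at hz
    have h1 := congrArg Complex.re hz
    have h2 := congrArg Complex.im hz
    simp at h1 h2
    constructor <;> linarith
  have e1 : S *ᵥ p = z.im • (E *ᵥ q) - z.re • (E *ᵥ p) := by
    ext i
    have := (hi i).1
    simp
    linarith
  have e2 : S *ᵥ q = -(z.im • (E *ᵥ p)) - z.re • (E *ᵥ q) := by
    ext i
    have := (hi i).2
    simp
    linarith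
  have symm : ∀ M : Matrix (Fin m) (Fin m) ℝ, M.IsSymm → q ⬝ᵥ M *ᵥ p = p ⬝ᵥ M *ᵥ q := by
    intro M hM
    rw [Matrix.dotProduct_mulVec, ← Matrix.mulVec_transpose, hM.eq, dotProduct_comm]
  have hEs : E.IsSymm := by
    have := hE.isHermitian
    rwa [Matrix.IsHermitian, Matrix.conjTranspose_eq_transpose_of_trivial] at this
  have key : z.im * (q ⬝ᵥ E *ᵥ q + p ⬝ᵥ E *ᵥ p) = 0 := by
    have := symm S hS
    rw [e1, e2] at this
    simp only [dotProduct_sub, dotProduct_neg, dotProduct_smul, smul_eq_mul] at this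
    rw [symm E hEs] at this
    linarith
  refine (mul_eq_zero.mp key).resolve_right (ne_of_gt ?_)
  have nn : ∀ x : Fin m → ℝ, 0 ≤ x ⬝ᵥ E *ᵥ x := fun x => by
    simpa using hE.posSemidef.dotProduct_mulVec_nonneg x
  have pos : ∀ x : Fin m → ℝ, x ≠ 0 → 0 < x ⬝ᵥ E *ᵥ x := fun x hx => by
    simpa using hE.dotProduct_mulVec_pos hx
  by_cases hq0 : q = 0
  · have hp0 : p ≠ 0 := by
      rintro hp0
      exact hu (funext fun i => Complex.ext (congrFun hp0 i) (congrFun hq0 i))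
    linarith [nn q, pos p hp0]
  · linarith [nn p, pos q hq0]

/-! ### Hyperbolicity -/

/-- The pencil `A(v) = v₁ A₁ + v₂ A₂ + v₃ A₃ + v₄ A₄`. -/
def vamosPencil (v : Fin 4 → ℝ) : Matrix (Fin 9) (Fin 9) ℝ :=
  v 0 • vamosA1 + v 1 • vamosA2 + v 2 • vamosA3 + v 3 • vamosA4

theorem vamosPencil_isSymm (v : Fin 4 → ℝ) : (vamosPencil v).IsSymm :=
  (((vamosA1_isSymm.smul _).add (vamosA2_isSymm.smul _)).add (vamosA3_isSymm.smul _)).add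
    (vamosA4_isSymm.smul _)

theorem vamosPencil_isHermitian (v : Fin 4 → ℝ) : (vamosPencil v).IsHermitian := by
  rw [Matrix.IsHermitian, Matrix.conjTranspose_eq_transpose_of_trivial, (vamosPencil_isSymm v).eq]

theorem vamosPencil_add_smul (x y : Fin 4 → ℝ) (s t : ℝ) :
    vamosPencil (s • x + t • y) = s • vamosPencil x + t • vamosPencil y := by
  simp only [vamosPencil, Pi.add_apply, Pi.smul_apply, smul_eq_mul, add_smul, mul_smul, smul_add]
  abel

open Matrix in
theorem quad_vamosPencil (v : Fin 4 → ℝ) (w : Fin 9 → ℝ) : (vamosPencil v).quad w =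
    v 0 * vamosA1.quad w + v 1 * vamosA2.quad w + v 2 * vamosA3.quad w + v 3 * vamosA4.quad w := by
  simp only [vamosPencil, Matrix.quad, Matrix.add_mulVec, Matrix.smul_mulVec, dotProduct_add,
    dotProduct_smul, smul_eq_mul]

open Matrix in
theorem vamosPencil_mulVec_vamosKernel (v : Fin 4 → ℝ) :
    vamosPencil v *ᵥ vamosKernel v = vamosEval (v 0) (v 1) (v 2) (v 3) • vamosCovec := by
  have h := pencil_mulVec_vamosKernel (RingHom.id ℝ) v
  have hid : ∀ M : Matrix (Fin 9) (Fin 9) ℝ, M.map (RingHom.id ℝ) = M := fun M => Matrix.map_id _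
  rw [hid, hid, hid, hid] at h
  rw [← h, vamosPencil]
  simp only [Matrix.add_mulVec, Matrix.smul_mulVec]

theorem quad_vamosPencil_vamosDir_pos {w : Fin 9 → ℝ} (hw : w ≠ 0) :
    0 < (vamosPencil vamosDir).quad w := by
  have h := half_sum_sq_le_quad_vamosDir w
  obtain ⟨i, hi⟩ := Function.ne_iff.mp hw
  have hpos : 0 < ∑ i, w i ^ 2 :=
    Finset.sum_pos' (fun j _ => sq_nonneg (w j)) ⟨i, Finset.mem_univ i, sq_pos_of_ne_zero hi⟩
  rw [quad_vamosPencil]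
  simp only [vamosDir]
  simp
  linarith

theorem vamosPencil_vamosDir_posDef : (vamosPencil vamosDir).PosDef :=
  Matrix.PosDef.of_dotProduct_mulVec_pos (vamosPencil_isHermitian _) fun w hw => by
    simpa using quad_vamosPencil_vamosDir_pos hw

theorem vamosPoly_isHomogeneous : vamosPoly.IsHomogeneous 4 := by
  have hX : ∀ i : Fin 4, (MvPolynomial.X i : MvPolynomial (Fin 4) ℝ).IsHomogeneous 1 :=
    fun i => MvPolynomial.isHomogeneous_X _ i
  have h4 : (4 : MvPolynomial (Fin 4) ℝ).IsHomogeneous 0 := MvPolynomial.isHomogeneous_C _ (4 : ℝ)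
  have h3 : ∀ i j k : Fin 4, (MvPolynomial.X i * MvPolynomial.X j * MvPolynomial.X k :
      MvPolynomial (Fin 4) ℝ).IsHomogeneous 3 := fun i j k => ((hX i).mul (hX j)).mul (hX k)
  exact (((hX 0).pow 2).mul ((hX 1).pow 2)).add
    ((h4.mul ((((hX 0).add (hX 1)).add (hX 2)).add (hX 3))).mul
      ((((h3 0 1 2).add (h3 0 1 3)).add (h3 0 2 3)).add (h3 1 2 3)))

open Matrix in
theorem vamosPoly_isHyperbolic : IsHyperbolic vamosPoly vamosDir := by
  refine ⟨⟨4, vamosPoly_isHomogeneous⟩, ?_, fun v z hz => ?_⟩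
  · rw [eval_vamosPoly]
    simp [vamosEval, vamosDir]
  · rw [aeval_vamosPoly] at hz
    set x : Fin 4 → ℂ := fun i => z * (vamosDir i : ℂ) + (v i : ℂ) with hx
    have hker := pencil_mulVec_vamosKernel Complex.ofRealHom x
    rw [hz, zero_smul] at hker
    by_contra him
    -- At a non-real zero the first two coordinates of `x` do not vanish, so `φ(x) ≠ 0`.
    have hne : ∀ r : ℝ, z + r ≠ 0 := fun r h0 => him (by simpa using congrArg Complex.im h0)
    have hu : vamosKernel x ≠ 0 := by
      intro h0
      have h1 := congrFun h0 0
      simp [vamosKernel, hx, vamosDir, hne] at h1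
    refine him (Matrix.PosDef.im_eq_zero_of_mulVec_eq_zero (vamosPencil_isSymm v)
      vamosPencil_vamosDir_posDef hu ?_)
    have hmap : ∀ y : Fin 4 → ℝ, (vamosPencil y).map Complex.ofRealHom *ᵥ vamosKernel x =
        (y 0 : ℂ) • (vamosA1.map Complex.ofRealHom *ᵥ vamosKernel x)
        + (y 1 : ℂ) • (vamosA2.map Complex.ofRealHom *ᵥ vamosKernel x)
        + (y 2 : ℂ) • (vamosA3.map Complex.ofRealHom *ᵥ vamosKernel x)
        + (y 3 : ℂ) • (vamosA4.map Complex.ofRealHom *ᵥ vamosKernel x) := by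
      intro y
      simp only [← Matrix.smul_mulVec, ← Matrix.add_mulVec]
      congr 1
      ext i j
      simp [vamosPencil]
    rw [← hker, hmap, hmap]
    ext i
    simp only [Pi.add_apply, Pi.smul_apply, smul_eq_mul, hx]
    ring

/-! ### The polyhedral outer cone -/

theorem vamosEval_comm (a b c d : ℝ) : vamosEval a b c d = vamosEval b a c d := by
  unfold vamosEval
  ring

theorem vamosEval_comm' (a b c d : ℝ) : vamosEval a b c d = vamosEval a b d c := by
  unfold vamosEval
  ring

/-- On the hyperplane `a + c = 0` the form `h₄` is `c² (b² - 4 (b + d)²)`. -/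
theorem vamosEval_neg_nonpos {b c d : ℝ} (hb : 0 ≤ b) (hd : 0 ≤ d) : vamosEval (-c) b c d ≤ 0 := by
  have e : vamosEval (-c) b c d = -(c ^ 2 * ((b + 2 * d) * (3 * b + 2 * d))) := by
    unfold vamosEval
    ring
  rw [e, neg_nonpos]
  positivity

/-- If `h₄` is positive on the ray `(a + t, b + t, c, d)`, `t > 0`, then that ray cannot cross the
set where the smaller of the first two coordinates is `k`, provided `h₄ ≤ 0` on this set. -/
theorem le_of_vamosEval_nonpos {a b c d k : ℝ}
    (H : ∀ t : ℝ, 0 < t → 0 < vamosEval (a + t) (b + t) c d)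
    (hk : ∀ y, k ≤ y → vamosEval k y c d ≤ 0) : k ≤ a ∧ k ≤ b := by
  by_contra hcon
  rw [not_and_or, not_le, not_le] at hcon
  rcases le_total a b with hab | hab
  · have hlt : a < k := by rcases hcon with h | h <;> linarith
    have h1 := H (k - a) (by linarith)
    rw [add_sub_cancel] at h1
    exact absurd (hk (b + (k - a)) (by linarith)) (not_le.mpr h1)
  · have hlt : b < k := by rcases hcon with h | h <;> linarith
    have h1 := H (k - b) (by linarith)
    rw [add_sub_cancel, vamosEval_comm] at h1
    exact absurd (hk (a + (k - b)) (by linarith)) (not_le.mpr h1)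

theorem neg_le_of_vamosEval_pos {a b c d : ℝ}
    (H : ∀ t : ℝ, 0 < t → 0 < vamosEval (a + t) (b + t) c d) (hc : c ≤ 0) (hd : -c ≤ d) :
    -c ≤ a ∧ -c ≤ b :=
  le_of_vamosEval_nonpos H fun _ hy => vamosEval_neg_nonpos (by linarith) (by linarith)

/-- With `c = -d - s` the bound says that `(a, b, c, d)` is a conical combination of `(1, 1, -1, 1)`
with coefficient `d`, of `(3, 3, -1, 0)` with coefficient `s`, and of the first two unit vectors. -/
theorem neg_three_mul_sub_le_of_vamosEval_pos {a b c d : ℝ}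
    (H : ∀ t : ℝ, 0 < t → 0 < vamosEval (a + t) (b + t) c d) (hd : 0 ≤ d) (hdc : d ≤ -c) :
    -3 * c - 2 * d ≤ a ∧ -3 * c - 2 * d ≤ b := by
  refine le_of_vamosEval_nonpos H fun y hy => ?_
  obtain ⟨s, rfl⟩ : ∃ s, c = -d - s := ⟨-d - c, by ring⟩
  have hs : 0 ≤ s := by linarith
  have hy0 : 0 ≤ y := by linarith
  have e : vamosEval (-3 * (-d - s) - 2 * d) y (-d - s) d =
      -((3 * s ^ 2 + 2 * s * d + 3 * d ^ 2) * y ^ 2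
        + 4 * y * ((d + 2 * s) * ((d + 3 * s) * s + (d + s) * d) + (d + s) * d * (d + 3 * s))
        + 4 * ((d + 2 * s) * (d + s) * d * (d + 3 * s))) := by
    unfold vamosEval
    ring
  rw [e, neg_nonpos]
  positivity

theorem neg_three_mul_add_le_of_vamosEval_pos {a b c d : ℝ}
    (H : ∀ t : ℝ, 0 < t → 0 < vamosEval (a + t) (b + t) c d) (hc : c ≤ 0) (hd : d ≤ 0) :
    -3 * (c + d) ≤ a ∧ -3 * (c + d) ≤ b := by
  refine le_of_vamosEval_nonpos H fun y hy => ?_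
  obtain ⟨m, hm⟩ : ∃ m, m = -(c + d) := ⟨_, rfl⟩
  have hm0 : 0 ≤ m := by linarith
  have hy3 : 3 * m ≤ y := by linarith
  have hw : 4 * (c * d) ≤ m ^ 2 := by rw [hm]; nlinarith [sq_nonneg (c - d)]
  have e : vamosEval (-3 * (c + d)) y c d = -(3 * m ^ 2 * y ^ 2) - 24 * m ^ 3 * y
      + 4 * (c * d) * ((2 * m + y) * (3 * m + y)) := by
    rw [hm]
    unfold vamosEval
    ring
  rw [e]
  have hy0 : 0 ≤ y := by linarith
  have h1 : 4 * (c * d) * ((2 * m + y) * (3 * m + y)) ≤ m ^ 2 * ((2 * m + y) * (3 * m + y)) :=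
    mul_le_mul_of_nonneg_right hw (by positivity)
  have h2 : 0 ≤ m ^ 2 * ((y - 3 * m) * y + y ^ 2 + 22 * m * (y - 3 * m) + 60 * m ^ 2) := by
    have : 0 ≤ y - 3 * m := by linarith
    positivity
  nlinarith [h1, h2]

/-- If `a + b < 0`, then the ray meets a point at which `h₄ ≤ 0`: one with opposite first two
coordinates if these are close, and otherwise the point whose smaller coordinate is
`-2 (c + d)`. -/
theorem add_nonneg_of_vamosEval_pos {a b c d : ℝ}
    (H : ∀ t : ℝ, 0 < t → 0 < vamosEval (a + t) (b + t) c d) (hc : 0 ≤ c) (hd : 0 ≤ d) :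
    0 ≤ a + b := by
  wlog hab : a ≤ b generalizing a b
  · rw [add_comm]
    exact this (fun t ht => by rw [vamosEval_comm]; exact H t ht) (le_of_not_ge hab)
  by_contra! hneg
  have hu : 0 ≤ c + d := add_nonneg hc hd
  rcases le_total (b - a) (4 * (c + d)) with hr | hr
  · have h1 := H (-(a + b) / 2) (by linarith)
    have e : vamosEval (a + -(a + b) / 2) (b + -(a + b) / 2) c d =
        ((b - a) / 2) ^ 2 * (((b - a) / 2) - 2 * (c + d)) * (((b - a) / 2) + 2 * (c + d)) := by
      unfold vamosEval
      ring
    rw [e] at h1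
    refine absurd h1 (not_lt.mpr ?_)
    refine mul_nonpos_of_nonpos_of_nonneg (mul_nonpos_of_nonneg_of_nonpos (by positivity) ?_) ?_ <;>
      linarith
  · have h1 := H (-a - 2 * (c + d)) (by linarith)
    obtain ⟨s, hs⟩ : ∃ s, s = b - a - 4 * (c + d) := ⟨_, rfl⟩
    have hs0 : 0 ≤ s := by linarith
    have hw : 4 * (c * d) ≤ (c + d) ^ 2 := by nlinarith [sq_nonneg (c - d)]
    obtain ⟨u, rfl⟩ : ∃ u, d = u - c := ⟨c + d, by ring⟩
    rw [add_sub_cancel] at hu hw hr h1 hs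
    rw [show a + (-a - 2 * u) = -2 * u by ring,
      show b + (-a - 2 * u) = s + 2 * u by rw [hs]; ring] at h1
    have e : vamosEval (-2 * u) (s + 2 * u) c (u - c) =
        -(4 * u ^ 2 * ((s + 2 * u) * s)) + 4 * (c * (u - c)) * ((s + u) * s) := by
      unfold vamosEval
      ring
    rw [e] at h1
    have h2 : 4 * (c * (u - c)) * ((s + u) * s) ≤ u ^ 2 * ((s + u) * s) :=
      mul_le_mul_of_nonneg_right hw (by positivity)
    have h3 : 0 ≤ u ^ 2 * (3 * s ^ 2 + 7 * u * s) := by positivity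
    nlinarith [h1, h2, h3]

theorem neg_le_add_of_vamosEval_pos {a b c d : ℝ}
    (H : ∀ t : ℝ, 0 < t → 0 < vamosEval (a + t) (b + t) c d) (hc : 0 ≤ c) (hd : 0 ≤ d) :
    -a ≤ b ∧ -a ≤ c ∧ -a ≤ d := by
  have hb := add_nonneg_of_vamosEval_pos H hc hd
  refine ⟨by linarith, ?_, ?_⟩
  · by_contra! hlt
    have h1 := H (-a - c) (by linarith)
    rw [show a + (-a - c) = -c by ring] at h1
    exact absurd (vamosEval_neg_nonpos (by linarith) hd) (not_le.mpr h1)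
  · by_contra! hlt
    have h1 := H (-a - d) (by linarith)
    rw [show a + (-a - d) = -d by ring, vamosEval_comm'] at h1
    exact absurd (vamosEval_neg_nonpos (by linarith) hc) (not_le.mpr h1)

/-- The hyperbolicity cone lies in the conical hull of ten rays: a linear functional
`(a, b, c, d) ↦ a p + b q + c r + d s` that is nonnegative on these rays is nonnegative on the
hyperbolicity cone. Each case of the proof belongs to four of the rays, and the inequalities
above say that `(a, b, c, d)` has nonnegative coordinates with respect to them. -/
theorem nonneg_of_vamosEval_pos {a b c d p q r s : ℝ}
    (H : ∀ t : ℝ, 0 < t → 0 < vamosEval (a + t) (b + t) c d)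
    (hp : 0 ≤ p) (hq : 0 ≤ q) (hr : 0 ≤ r) (hs : 0 ≤ s)
    (h1 : 0 ≤ -p + q + r + s) (h2 : 0 ≤ p - q + r + s) (h3 : 0 ≤ p + q - r + s)
    (h4 : 0 ≤ p + q + r - s) (h5 : 0 ≤ 3 * p + 3 * q - r) (h6 : 0 ≤ 3 * p + 3 * q - s) :
    0 ≤ a * p + b * q + c * r + d * s := by
  wlog hcd : c ≤ d generalizing c d r s
  · have := this (c := d) (d := c) (r := s) (s := r)
      (fun t ht => by rw [vamosEval_comm']; exact H t ht) hs hr (by linarith) (by linarith)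
      (by linarith) (by linarith) h6 h5 (le_of_not_ge hcd)
    linarith
  rcases le_total 0 c with hc | hc
  · have hd : 0 ≤ d := hc.trans hcd
    rcases le_total 0 a with ha | ha
    · rcases le_total 0 b with hb | hb
      · positivity
      · obtain ⟨k1, k2, k3⟩ := neg_le_add_of_vamosEval_pos (a := b) (b := a)
          (fun t ht => by rw [vamosEval_comm]; exact H t ht) hc hd
        linarith [mul_nonneg (neg_nonneg.mpr hb) h2, mul_nonneg (sub_nonneg.mpr k1) hp,
          mul_nonneg (sub_nonneg.mpr k2) hr, mul_nonneg (sub_nonneg.mpr k3) hs]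
    · obtain ⟨k1, k2, k3⟩ := neg_le_add_of_vamosEval_pos H hc hd
      linarith [mul_nonneg (neg_nonneg.mpr ha) h1, mul_nonneg (sub_nonneg.mpr k1) hq,
        mul_nonneg (sub_nonneg.mpr k2) hr, mul_nonneg (sub_nonneg.mpr k3) hs]
  · rcases le_total (-c) d with hd | hd
    · obtain ⟨k1, k2⟩ := neg_le_of_vamosEval_pos H hc hd
      linarith [mul_nonneg (neg_nonneg.mpr hc) h3, mul_nonneg (sub_nonneg.mpr k1) hp,
        mul_nonneg (sub_nonneg.mpr k2) hq, mul_nonneg (sub_nonneg.mpr hd) hs]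
    · rcases le_total 0 d with hd0 | hd0
      · obtain ⟨k1, k2⟩ := neg_three_mul_sub_le_of_vamosEval_pos H hd0 hd
        linarith [mul_nonneg hd0 h3, mul_nonneg (sub_nonneg.mpr hd) h5,
          mul_nonneg (sub_nonneg.mpr k1) hp, mul_nonneg (sub_nonneg.mpr k2) hq]
      · obtain ⟨k1, k2⟩ := neg_three_mul_add_le_of_vamosEval_pos H hc hd0
        linarith [mul_nonneg (neg_nonneg.mpr hc) h5, mul_nonneg (neg_nonneg.mpr hd0) h6,
          mul_nonneg (sub_nonneg.mpr k1) hp, mul_nonneg (sub_nonneg.mpr k2) hq]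

/-! ### The hyperbolicity cone -/

open Matrix in
/-- Positive semidefiniteness of the pencil implies membership in the hyperbolicity cone. At a zero
`x = t e + v` with `t > 0` the matrix `A(x)` is positive definite, so `φ(x) = 0`; this forces one of
the first two coordinates to vanish, against the positivity of the last diagonal entries. -/
theorem mem_hyperbolicityCone_of_posSemidef {v : Fin 4 → ℝ} (hv : (vamosPencil v).PosSemidef) :
    v ∈ hyperbolicityCone vamosPoly vamosDir := by
  intro t ht hpos
  rw [eval_vamosPoly] at ht
  set x := t • vamosDir + v with hx
  have hP : (vamosPencil x).PosDef := by
    have e : vamosPencil x = t • vamosPencil vamosDir + vamosPencil v := by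
      have := vamosPencil_add_smul vamosDir v t 1
      rwa [one_smul, one_smul] at this
    rw [e]
    exact (vamosPencil_vamosDir_posDef.smul hpos).add_posSemidef hv
  have hker := vamosPencil_mulVec_vamosKernel x
  rw [ht, zero_smul] at hker
  have h0 : vamosKernel x = 0 := by
    by_contra hne
    have := hP.dotProduct_mulVec_pos hne
    rw [hker, dotProduct_zero] at this
    exact lt_irrefl _ this
  have k0 : x 0 ^ 2 * x 1 = 0 := congrFun h0 0
  have k5 : x 1 * x 3 * (x 1 + x 2 + x 3) = 0 := congrFun h0 5
  have k6 : x 0 * x 3 * (x 0 + x 2 + x 3) = 0 := congrFun h0 6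
  have k4 : x 2 * x 3 * (x 0 + x 1 + x 2 + x 3) = 0 := congrFun h0 4
  have d5 : 0 < x 0 + x 2 := by
    have := hP.diag_pos (i := 5)
    simp [vamosPencil, vamosA1, vamosA2, vamosA3, vamosA4] at this
    linarith
  have d6 : 0 < x 1 + x 2 := by
    have := hP.diag_pos (i := 6)
    simp [vamosPencil, vamosA1, vamosA2, vamosA3, vamosA4] at this
    linarith
  have d7 : 0 < x 0 + x 3 := by
    have := hP.diag_pos (i := 7)
    simp [vamosPencil, vamosA1, vamosA2, vamosA3, vamosA4] at this
    linarith
  have d8 : 0 < x 1 + x 3 := by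
    have := hP.diag_pos (i := 8)
    simp [vamosPencil, vamosA1, vamosA2, vamosA3, vamosA4] at this
    linarith
  rcases mul_eq_zero.mp k0 with hx0 | hx1
  · have hx0 : x 0 = 0 := by simpa using hx0
    rw [hx0, zero_add] at d5 d7 k4
    have : 0 < x 2 * x 3 * (x 1 + x 2 + x 3) := by have := add_pos d6 d7; positivity
    exact this.ne' k4
  · rw [hx1, zero_add] at d6 d8
    rw [hx1, add_zero] at k4
    have : 0 < x 2 * x 3 * (x 0 + x 2 + x 3) := by have := add_pos d5 d8; positivity
    exact this.ne' k4

/-- Applied to polynomials in `e + s v`, which by homogeneity correspond to polynomials in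
`t e + v` with `t = 1 / s`. -/
theorem pos_of_continuous_of_ne_zero {g : ℝ → ℝ} (hg : Continuous g) (h0 : 0 < g 0)
    (hne : ∀ s, 0 < s → g s ≠ 0) {s : ℝ} (hs : 0 < s) : 0 < g s := by
  by_contra! hle
  obtain ⟨r, hr, hr0⟩ := intermediate_value_Icc' hs.le hg.continuousOn ⟨hle, h0.le⟩
  rcases hr.1.eq_or_lt with rfl | hlt
  · exact h0.ne' hr0
  · exact hne r hlt hr0

theorem vamosEval_smul (k a b c d : ℝ) :
    vamosEval (k * a) (k * b) (k * c) (k * d) = k ^ 4 * vamosEval a b c d := by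
  unfold vamosEval
  ring

theorem vamosEval_one_add_pos {v : Fin 4 → ℝ} (hv : v ∈ hyperbolicityCone vamosPoly vamosDir)
    {s : ℝ} (hs : 0 < s) : 0 < vamosEval (1 + s * v 0) (1 + s * v 1) (s * v 2) (s * v 3) := by
  refine pos_of_continuous_of_ne_zero
    (g := fun s => vamosEval (1 + s * v 0) (1 + s * v 1) (s * v 2) (s * v 3))
    (by unfold vamosEval; fun_prop) (by simp [vamosEval]) (fun s hs h => ?_) hs
  refine hv s⁻¹ ?_ (inv_pos.mpr hs)
  rw [eval_vamosPoly]
  have e := vamosEval_smul s⁻¹ (1 + s * v 0) (1 + s * v 1) (s * v 2) (s * v 3)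
  rw [h, mul_zero] at e
  rw [← e]
  simp only [Pi.add_apply, Pi.smul_apply, vamosDir, smul_eq_mul]
  simp [mul_add, hs.ne']

theorem vamosEval_add_pos {v : Fin 4 → ℝ} (hv : v ∈ hyperbolicityCone vamosPoly vamosDir)
    {t : ℝ} (ht : 0 < t) : 0 < vamosEval (v 0 + t) (v 1 + t) (v 2) (v 3) := by
  have h := vamosEval_one_add_pos hv (inv_pos.mpr ht)
  have e := vamosEval_smul t (1 + t⁻¹ * v 0) (1 + t⁻¹ * v 1) (t⁻¹ * v 2) (t⁻¹ * v 3)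
  rw [mul_add, mul_add, mul_inv_cancel_left₀ ht.ne', mul_inv_cancel_left₀ ht.ne',
    mul_inv_cancel_left₀ ht.ne', mul_inv_cancel_left₀ ht.ne', mul_one, add_comm t, add_comm t] at e
  rw [e]
  positivity

open Matrix in
/-- On the hyperplane `cᵀ w = 0` the pencil is positive semidefinite over the whole polyhedral
cone, in particular over the hyperbolicity cone. -/
theorem quad_vamosPencil_nonneg_of_dotProduct_eq_zero {v : Fin 4 → ℝ}
    (hv : v ∈ hyperbolicityCone vamosPoly vamosDir) {w : Fin 9 → ℝ}
    (hw : vamosCovec ⬝ᵥ w = 0) : 0 ≤ (vamosPencil v).quad w := by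
  rw [quad_vamosPencil]
  exact nonneg_of_vamosEval_pos (fun t ht => vamosEval_add_pos hv ht)
    (quad_vamosA1_nonneg w) (quad_vamosA2_nonneg w) (quad_vamosA3_nonneg w) (quad_vamosA4_nonneg w)
    (quad_neg_pos_pos_pos_nonneg hw) (quad_pos_neg_pos_pos_nonneg hw)
    (quad_pos_pos_neg_pos_nonneg hw) (quad_pos_pos_pos_neg_nonneg hw) (quad_three_three_neg_zero_nonneg hw)
    (quad_three_three_zero_neg_nonneg hw)

open Matrix in
theorem posSemidef_of_mem_hyperbolicityCone {v : Fin 4 → ℝ}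
    (hv : v ∈ hyperbolicityCone vamosPoly vamosDir) : (vamosPencil v).PosSemidef := by
  have hquad : ∀ (s : ℝ) (w : Fin 9 → ℝ), (vamosPencil (vamosDir + s • v)).quad w =
      (vamosPencil vamosDir).quad w + s * (vamosPencil v).quad w := by
    intro s w
    have := vamosPencil_add_smul vamosDir v 1 s
    rw [one_smul, one_smul] at this
    rw [this]
    simp only [Matrix.quad, Matrix.add_mulVec, Matrix.smul_mulVec, dotProduct_add, dotProduct_smul,
      smul_eq_mul]
  have hval : ∀ s : ℝ, 0 < s → 0 < vamosEval ((vamosDir + s • v) 0) ((vamosDir + s • v) 1)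
      ((vamosDir + s • v) 2) ((vamosDir + s • v) 3) := by
    intro s hs
    have := vamosEval_one_add_pos hv hs
    simpa [vamosDir] using this
  -- The cubic form `cᵀ φ` is positive at `e`. It cannot vanish at `e + s v`: there `φ` would lie in
  -- the hyperplane on which `A(e)` is positive definite and `A(v)` positive semidefinite, while the
  -- form takes the value `h₄ · cᵀ φ = 0` at `φ`; hence `φ = 0`, against `h₄ · c = A φ`.
  have hG : ∀ s : ℝ, 0 < s → 0 < vamosCovec ⬝ᵥ vamosKernel (vamosDir + s • v) := by
    intro s hs
    refine pos_of_continuous_of_ne_zero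
      (g := fun s => vamosCovec ⬝ᵥ vamosKernel (vamosDir + s • v)) ?_ ?_ (fun s hs h => ?_) hs
    · simp only [vamosCovec_dotProduct, vamosKernel, Pi.add_apply, Pi.smul_apply, smul_eq_mul]
      simp
      fun_prop
    · simp only [vamosCovec_dotProduct, vamosKernel, vamosDir]
      simp
    · have hker := vamosPencil_mulVec_vamosKernel (vamosDir + s • v)
      have hq0 : (vamosPencil (vamosDir + s • v)).quad (vamosKernel (vamosDir + s • v)) = 0 := by
        rw [Matrix.quad, hker, dotProduct_smul, dotProduct_comm, h, smul_zero]
      rw [hquad] at hq0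
      have hnn := quad_vamosPencil_nonneg_of_dotProduct_eq_zero hv h
      have hz : vamosKernel (vamosDir + s • v) = 0 := by
        by_contra hne
        have h1 := quad_vamosPencil_vamosDir_pos hne
        have h2 := mul_nonneg hs.le hnn
        linarith
      rw [hz, mulVec_zero] at hker
      have h0 := congrFun hker 0
      have := hval s hs
      simp [vamosCovec] at h0
      exact this.ne' h0
  have hmain : ∀ (s : ℝ) (w : Fin 9 → ℝ), 0 < s →
      0 ≤ (vamosPencil (vamosDir + s • v)).quad w := by
    intro s w hs
    set x := vamosDir + s • v with hx
    set y := vamosKernel x with hy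
    set k := (vamosCovec ⬝ᵥ w) / (vamosCovec ⬝ᵥ y) with hk
    -- Split off from `w` the multiple of `φ(x)` that leaves a vector `u` orthogonal to `c`; the
    -- mixed term vanishes because `A(x) φ(x)` is a multiple of `c`.
    obtain ⟨u, hu⟩ : ∃ u, u = w - k • y := ⟨_, rfl⟩
    have hcu : vamosCovec ⬝ᵥ u = 0 := by
      rw [hu, dotProduct_sub, dotProduct_smul, smul_eq_mul, hk,
        div_mul_cancel₀ _ (hG s hs).ne', sub_self]
    have hw : w = u + k • y := by rw [hu, sub_add_cancel]
    have hker := vamosPencil_mulVec_vamosKernel x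
    rw [← hy] at hker
    have huy : u ⬝ᵥ vamosPencil x *ᵥ y = 0 := by
      rw [hker, dotProduct_smul, dotProduct_comm, hcu, smul_zero]
    have hyu : y ⬝ᵥ vamosPencil x *ᵥ u = 0 := by
      rw [dotProduct_mulVec, ← mulVec_transpose, (vamosPencil_isSymm x).eq, dotProduct_comm, huy]
    have hyy : 0 ≤ y ⬝ᵥ vamosPencil x *ᵥ y := by
      rw [hker, dotProduct_smul, dotProduct_comm]
      exact mul_nonneg (hval s hs).le (hG s hs).le
    have huu : 0 ≤ (vamosPencil x).quad u := by
      rw [hquad]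
      refine add_nonneg ?_ (mul_nonneg hs.le (quad_vamosPencil_nonneg_of_dotProduct_eq_zero hv hcu))
      by_cases hu0 : u = 0
      · simp [hu0]
      · exact (quad_vamosPencil_vamosDir_pos hu0).le
    have e : (vamosPencil x).quad w
        = (vamosPencil x).quad u + k ^ 2 * (y ⬝ᵥ vamosPencil x *ᵥ y) := by
      rw [hw]
      simp only [Matrix.quad, mulVec_add, mulVec_smul, dotProduct_add, add_dotProduct,
        smul_dotProduct, dotProduct_smul, smul_eq_mul, huy, hyu]
      ring
    rw [e]
    positivity
  refine Matrix.PosSemidef.of_dotProduct_mulVec_nonneg (vamosPencil_isHermitian v) fun w => ?_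
  rw [star_trivial]
  change 0 ≤ (vamosPencil v).quad w
  by_contra! hneg
  -- `A(e) + s A(v)` would take a negative value at `w` for large `s`.
  obtain ⟨s, hs1, hs0⟩ : ∃ s : ℝ,
      (vamosPencil vamosDir).quad w + s * (vamosPencil v).quad w < 0 ∧ 0 < s := by
    refine ⟨(|(vamosPencil vamosDir).quad w| + 1) / -(vamosPencil v).quad w, ?_, ?_⟩
    · rw [div_neg, neg_mul, div_mul_cancel₀ _ hneg.ne]
      linarith [le_abs_self ((vamosPencil vamosDir).quad w)]
    · have := neg_pos.mpr hneg
      positivity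
  have := hmain s w hs0
  rw [hquad] at this
  linarith

theorem hyperbolicityCone_vamosPoly : hyperbolicityCone vamosPoly vamosDir =
    {v : Fin 4 → ℝ |
      (v 0 • vamosA1 + v 1 • vamosA2 + v 2 • vamosA3 + v 3 • vamosA4).PosSemidef} :=
  Set.ext fun _ => ⟨posSemidef_of_mem_hyperbolicityCone, mem_hyperbolicityCone_of_posSemidef⟩

theorem isSpectrahedralCone_hyperbolicityCone_vamosPoly :
    IsSpectrahedralCone (hyperbolicityCone vamosPoly vamosDir) := by
  refine ⟨9, ![vamosA1, vamosA2, vamosA3, vamosA4], fun i => ?_, ?_⟩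
  · fin_cases i
    exacts [vamosA1_isSymm, vamosA2_isSymm, vamosA3_isSymm, vamosA4_isSymm]
  · rw [hyperbolicityCone_vamosPoly]
    simp [linearPencil, Fin.sum_univ_four]

/-! ### Determinants of definite pencils and nullity -/

open Matrix in
theorem eval_pencilDet {n m : ℕ} (A : Fin n → Matrix (Fin m) (Fin m) ℝ) (v : Fin n → ℝ) :
    MvPolynomial.eval v (pencilDet A) = (linearPencil A v).det := by
  rw [pencilDet, RingHom.map_det]
  congr 1
  ext i j
  simp [linearPencil, Matrix.sum_apply]

open Matrix MatrixOrder in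
theorem Matrix.PosDef.exists_isUnit_eq_transpose_mul_self {m : ℕ} {P : Matrix (Fin m) (Fin m) ℝ}
    (hP : P.PosDef) : ∃ C : Matrix (Fin m) (Fin m) ℝ, IsUnit C ∧ P = Cᵀ * C := by
  obtain ⟨C, hC⟩ := CStarAlgebra.nonneg_iff_eq_star_mul_self.mp hP.posSemidef.nonneg
  have hU := hP.isUnit
  rw [hC] at hU
  exact ⟨C, isUnit_of_mul_isUnit_right hU, by rw [hC]; rfl⟩

open Matrix in
/-- Simultaneous diagonalisation of a positive definite `P` and a symmetric `Q`: the pencil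
`t P + Q` factors through the eigenvalues of `Q` relative to `P`. -/
theorem Matrix.PosDef.exists_det_smul_add_eq {m : ℕ} {P Q : Matrix (Fin m) (Fin m) ℝ}
    (hP : P.PosDef) (hQ : Q.IsSymm) :
    ∃ (c : ℝ) (l : Fin m → ℝ), c ≠ 0 ∧ (∀ t : ℝ, (t • P + Q).det = c * ∏ i, (t + l i)) ∧
      Q.rank = Fintype.card {i // l i ≠ 0} ∧ ((∀ i, 0 ≤ l i) → Q.PosSemidef) := by
  obtain ⟨C, hC, rfl⟩ := hP.exists_isUnit_eq_transpose_mul_self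
  have hd : IsUnit C.det := (Matrix.isUnit_iff_isUnit_det C).mp hC
  set R := (C⁻¹)ᵀ * Q * C⁻¹ with hR
  have hRH : R.IsHermitian := by
    rw [Matrix.IsHermitian, Matrix.conjTranspose_eq_transpose_of_trivial, hR]
    simp [Matrix.transpose_mul, hQ.eq, Matrix.mul_assoc]
  have h1 : C⁻¹ * C = 1 := Matrix.nonsing_inv_mul C hd
  have h2 : Cᵀ * (C⁻¹)ᵀ = 1 := by rw [← Matrix.transpose_mul, h1, Matrix.transpose_one]
  have hQR : Q = Cᵀ * R * C := by
    calc Q = (Cᵀ * (C⁻¹)ᵀ) * Q * (C⁻¹ * C) := by rw [h1, h2, Matrix.one_mul, Matrix.mul_one]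
      _ = Cᵀ * R * C := by simp only [hR, Matrix.mul_assoc]
  refine ⟨C.det * C.det, hRH.eigenvalues, mul_ne_zero hd.ne_zero hd.ne_zero, fun t => ?_, ?_,
    fun h => ?_⟩
  · have e1 : t • (Cᵀ * C) + Q = Cᵀ * (t • (1 : Matrix (Fin m) (Fin m) ℝ) + R) * C := by
      rw [Matrix.mul_add, Matrix.add_mul, ← hQR]; simp
    have e2 : (t • (1 : Matrix (Fin m) (Fin m) ℝ) + R).det = ∏ i, (t + hRH.eigenvalues i) := by
      have e3 : t • (1 : Matrix (Fin m) (Fin m) ℝ) + R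
          = -(Matrix.scalar (Fin m) (-t) - R) := by
        ext i j
        by_cases hij : i = j <;> simp [hij, add_comm]
      rw [e3, Matrix.det_neg, ← Matrix.eval_charpoly, hRH.charpoly_eq, Polynomial.eval_prod,
        Fintype.card_fin, ← Fin.prod_const, ← Finset.prod_mul_distrib]
      refine Finset.prod_congr rfl fun i _ => ?_
      simp
      ring
    rw [e1, Matrix.det_mul, Matrix.det_mul, Matrix.det_transpose, e2]
    ring
  · rw [← hRH.rank_eq_card_non_zero_eigs]
    conv_lhs => rw [hQR]
    rw [Matrix.rank_mul_eq_left_of_isUnit_det _ _ hd,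
      Matrix.rank_mul_eq_right_of_isUnit_det _ _ (by rwa [Matrix.det_transpose])]
  · have hRP : R.PosSemidef := hRH.posSemidef_iff_eigenvalues_nonneg.mpr h
    have := hRP.conjTranspose_mul_mul_same C
    rwa [Matrix.conjTranspose_eq_transpose_of_trivial, ← hQR] at this

open Polynomial in
theorem Polynomial.eq_of_X_pow_mul_eq_X_pow_mul {f g : ℝ[X]} {a b : ℕ} (hf : f.eval 0 ≠ 0)
    (hg : g.eval 0 ≠ 0) (h : X ^ a * f = X ^ b * g) : a = b := by
  have hc : ∀ p : ℝ[X], p.eval 0 ≠ 0 → ∀ k, (X ^ k * p).natTrailingDegree = k := by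
    intro p hp k
    have hp0 : p ≠ 0 := by rintro rfl; simp at hp
    rw [mul_comm, natTrailingDegree_mul_X_pow hp0, natTrailingDegree_eq_zero.mpr, zero_add]
    right
    rwa [coeff_zero_eq_eval_zero]
  rw [← hc f hf a, h, hc g hg b]

open Matrix Polynomial in
/-- The order of vanishing of `det (t P + Q)` at `t = 0` is the nullity of `Q`. -/
theorem Matrix.PosDef.finrank_ker_eq {m : ℕ} {P Q : Matrix (Fin m) (Fin m) ℝ}
    (hP : P.PosDef) (hQ : Q.IsSymm) {k : ℕ} {g : ℝ[X]} (hg : g.eval 0 ≠ 0)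
    (h : ∀ t : ℝ, (t • P + Q).det = t ^ k * g.eval t) :
    Module.finrank ℝ (LinearMap.ker Q.mulVecLin) = k := by
  obtain ⟨c, l, hc, hdet, hrank, -⟩ := hP.exists_det_smul_add_eq hQ
  have hk := LinearMap.finrank_range_add_finrank_ker Q.mulVecLin
  rw [Module.finrank_fin_fun] at hk
  have hcard : Fintype.card {i // l i ≠ 0} + (Finset.univ.filter fun i => l i = 0).card = m := by
    rw [Fintype.card_subtype, add_comm, Finset.card_filter_add_card_filter_not, Finset.card_univ,
      Fintype.card_fin]
  have hr : Module.finrank ℝ (LinearMap.range Q.mulVecLin) = Fintype.card {i // l i ≠ 0} := hrank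
  have key : (Finset.univ.filter fun i => l i = 0).card = k := by
    refine Polynomial.eq_of_X_pow_mul_eq_X_pow_mul
      (f := C c * ∏ i ∈ Finset.univ.filter (fun i => ¬ l i = 0), (X + C (l i))) ?_ hg ?_
    · simp only [eval_mul, eval_C, eval_prod, eval_add, eval_X, zero_add]
      exact mul_ne_zero hc (Finset.prod_ne_zero_iff.mpr fun i hi => (Finset.mem_filter.mp hi).2)
    · refine Polynomial.funext fun t => ?_
      simp only [eval_mul, eval_C, eval_prod, eval_add, eval_X, eval_pow]
      rw [← h, hdet, ← Finset.prod_filter_mul_prod_filter_not Finset.univ (fun i => l i = 0)]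
      have hz : ∏ i with l i = 0, (t + l i) = t ^ (Finset.univ.filter fun i => l i = 0).card := by
        rw [← Finset.prod_const]
        exact Finset.prod_congr rfl fun i hi => by rw [(Finset.mem_filter.mp hi).2, add_zero]
      rw [hz]
      ring
  omega

open Matrix in
theorem Matrix.PosDef.posSemidef_of_det_ne_zero {m : ℕ} {P Q : Matrix (Fin m) (Fin m) ℝ}
    (hP : P.PosDef) (hQ : Q.IsSymm) (h : ∀ t : ℝ, 0 < t → (t • P + Q).det ≠ 0) :
    Q.PosSemidef := by
  obtain ⟨c, l, hc, hdet, -, hpsd⟩ := hP.exists_det_smul_add_eq hQ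
  refine hpsd fun i => ?_
  by_contra! hi
  refine h (-l i) (by linarith) ?_
  rw [hdet, Finset.prod_eq_zero (Finset.mem_univ i) (by ring), mul_zero]

open Matrix in
theorem Matrix.PosSemidef.ker_add {m : ℕ} {X Y : Matrix (Fin m) (Fin m) ℝ}
    (hX : X.PosSemidef) (hY : Y.PosSemidef) :
    LinearMap.ker (X + Y).mulVecLin = LinearMap.ker X.mulVecLin ⊓ LinearMap.ker Y.mulVecLin := by
  ext w
  simp only [Submodule.mem_inf, LinearMap.mem_ker, Matrix.mulVecLin_apply]
  constructor
  · intro hw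
    have h0 : star w ⬝ᵥ X *ᵥ w + star w ⬝ᵥ Y *ᵥ w = 0 := by
      rw [← dotProduct_add, ← Matrix.add_mulVec, hw, dotProduct_zero]
    have hx := hX.dotProduct_mulVec_nonneg w
    have hy := hY.dotProduct_mulVec_nonneg w
    exact ⟨(hX.dotProduct_mulVec_zero_iff w).mp (by linarith),
      (hY.dotProduct_mulVec_zero_iff w).mp (by linarith)⟩
  · rintro ⟨hx, hy⟩
    rw [Matrix.add_mulVec, hx, hy, add_zero]

/-! ### The absence of definite determinantal representations -/

/-- A dual form of the failure of the Ingleton inequality: no four subspaces have the intersection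
dimensions that the Vámos matroid prescribes. -/
theorem eq_zero_of_finrank_inf {V : Type*} [AddCommGroup V] [Module ℝ V] [FiniteDimensional ℝ V]
    {N : ℕ} (K : Fin 4 → Submodule ℝ V) (h1 : ∀ i, Module.finrank ℝ (K i) = 2 * N)
    (h01 : Module.finrank ℝ ↥(K 0 ⊓ K 1) = 0)
    (h02 : Module.finrank ℝ ↥(K 0 ⊓ K 2) = N) (h03 : Module.finrank ℝ ↥(K 0 ⊓ K 3) = N)
    (h12 : Module.finrank ℝ ↥(K 1 ⊓ K 2) = N) (h13 : Module.finrank ℝ ↥(K 1 ⊓ K 3) = N)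
    (h23 : Module.finrank ℝ ↥(K 2 ⊓ K 3) = N)
    (h023 : Module.finrank ℝ ↥(K 0 ⊓ K 2 ⊓ K 3) = 0)
    (h123 : Module.finrank ℝ ↥(K 1 ⊓ K 2 ⊓ K 3) = 0) : N = 0 := by
  have le_sup : ∀ U A B : Submodule ℝ V, Module.finrank ℝ U = 2 * N →
      Module.finrank ℝ ↥(U ⊓ A) = N → Module.finrank ℝ ↥(U ⊓ B) = N →
      Module.finrank ℝ ↥(U ⊓ A ⊓ B) = 0 → U ≤ A ⊔ B := by
    intro U A B hU hA hB hAB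
    have hd := Submodule.finrank_sup_add_finrank_inf_eq (U ⊓ A) (U ⊓ B)
    have he : (U ⊓ A) ⊓ (U ⊓ B) = U ⊓ A ⊓ B := by
      rw [inf_inf_inf_comm, inf_idem, inf_assoc]
    rw [he, hAB, hA, hB] at hd
    have hs : (U ⊓ A) ⊔ (U ⊓ B) = U :=
      Submodule.eq_of_le_of_finrank_eq (sup_le inf_le_left inf_le_left) (by omega)
    rw [← hs]
    exact sup_le_sup inf_le_right inf_le_right
  have hW := Submodule.finrank_sup_add_finrank_inf_eq (K 2) (K 3)
  have h01' := Submodule.finrank_sup_add_finrank_inf_eq (K 0) (K 1)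
  have hle : K 0 ⊔ K 1 ≤ K 2 ⊔ K 3 :=
    sup_le (le_sup _ _ _ (h1 0) h02 h03 h023) (le_sup _ _ _ (h1 1) h12 h13 h123)
  have := Submodule.finrank_mono hle
  have a0 := h1 0
  have a1 := h1 1
  have a2 := h1 2
  have a3 := h1 3
  omega

open Matrix Polynomial in
theorem not_hasDefiniteDetRep_vamosPoly_pow {N : ℕ} (hN : 1 ≤ N) :
    ¬ HasDefiniteDetRep (vamosPoly ^ N) vamosDir := by
  rintro ⟨m, B, hsymm, hP, hdet⟩
  set P := linearPencil B vamosDir with hPdef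
  have hsy : ∀ v, (linearPencil B v).IsSymm := fun v => by
    rw [Matrix.IsSymm, linearPencil, Matrix.transpose_sum]
    exact Finset.sum_congr rfl fun i _ => by rw [Matrix.transpose_smul, (hsymm i).eq]
  have hd : ∀ (v : Fin 4 → ℝ) (t : ℝ), (t • P + linearPencil B v).det =
      ((t + v 0) ^ 2 * (t + v 1) ^ 2 + 4 * ((t + v 0) + (t + v 1) + v 2 + v 3) *
        ((t + v 0) * (t + v 1) * v 2 + (t + v 0) * (t + v 1) * v 3 + (t + v 0) * v 2 * v 3
          + (t + v 1) * v 2 * v 3)) ^ N := by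
    intro v t
    have e : t • P + linearPencil B v = linearPencil B (t • vamosDir + v) := by
      simp only [hPdef, linearPencil, Finset.smul_sum, ← Finset.sum_add_distrib]
      exact Finset.sum_congr rfl fun i _ => by
        rw [Pi.add_apply, Pi.smul_apply, add_smul, smul_eq_mul, mul_smul]
    rw [e, ← eval_pencilDet, ← hdet, map_pow, eval_vamosPoly, vamosEval]
    simp [vamosDir]
  have hker : ∀ (v : Fin 4 → ℝ) (k : ℕ) (g : ℝ[X]), g.eval 0 ≠ 0 →
      (∀ t : ℝ, (t + v 0) ^ 2 * (t + v 1) ^ 2 + 4 * ((t + v 0) + (t + v 1) + v 2 + v 3) *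
        ((t + v 0) * (t + v 1) * v 2 + (t + v 0) * (t + v 1) * v 3 + (t + v 0) * v 2 * v 3
          + (t + v 1) * v 2 * v 3) = t ^ k * g.eval t) →
      Module.finrank ℝ (LinearMap.ker (linearPencil B v).mulVecLin) = k * N := by
    intro v k g hg h
    refine hP.finrank_ker_eq (hsy v) (g := g ^ N) ?_ fun t => ?_
    · rw [eval_pow]
      exact pow_ne_zero _ hg
    · rw [hd, h, mul_pow, ← pow_mul, eval_pow]
  -- The coefficient matrices are positive semidefinite because `h₄ (t e + v)` has no positive zero
  -- for a unit vector `v`.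
  have hB : ∀ i, linearPencil B (Pi.single i 1) = B i := by
    intro i
    rw [linearPencil, Finset.sum_eq_single i]
    · simp
    · intro j _ hj
      simp [hj]
    · simp
  have hpsd : ∀ i, (B i).PosSemidef := by
    intro i
    rw [← hB i]
    refine hP.posSemidef_of_det_ne_zero (hsy _) fun t ht => ?_
    rw [hd]
    refine pow_ne_zero _ (ne_of_gt ?_)
    fin_cases i <;> simp <;> positivity
  have hk1 : ∀ i, LinearMap.ker (B i).mulVecLin
      = LinearMap.ker (linearPencil B (Pi.single i 1)).mulVecLin := fun i => by rw [hB]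
  have hk2 : ∀ i j, LinearMap.ker (B i).mulVecLin ⊓ LinearMap.ker (B j).mulVecLin
      = LinearMap.ker (linearPencil B (Pi.single i 1 + Pi.single j 1)).mulVecLin := by
    intro i j
    rw [← (hpsd i).ker_add (hpsd j), ← hB i, ← hB j]
    simp only [linearPencil, ← Finset.sum_add_distrib, Pi.add_apply, add_smul]
  have hk3 : ∀ i j k, LinearMap.ker (B i).mulVecLin ⊓ LinearMap.ker (B j).mulVecLin
        ⊓ LinearMap.ker (B k).mulVecLin = LinearMap.ker
          (linearPencil B (Pi.single i 1 + Pi.single j 1 + Pi.single k 1)).mulVecLin := by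
    intro i j k
    rw [← (hpsd i).ker_add (hpsd j), ← ((hpsd i).add (hpsd j)).ker_add (hpsd k), ← hB i, ← hB j,
      ← hB k]
    simp only [linearPencil, ← Finset.sum_add_distrib, Pi.add_apply, add_smul]
  suffices N = 0 by omega
  -- It remains to read off the orders of vanishing from `h₄ (t e + v) = t ^ k * g t`, `g 0 ≠ 0`.
  refine eq_zero_of_finrank_inf (fun i => LinearMap.ker (B i).mulVecLin) (fun i => ?_)
    ?_ ?_ ?_ ?_ ?_ ?_ ?_ ?_
  · rw [hk1]
    fin_cases i
    · exact hker _ 2 ((X + 1) ^ 2) (by simp) fun t => by simp; ring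
    · exact hker _ 2 ((X + 1) ^ 2) (by simp) fun t => by simp
    · exact hker _ 2 (X ^ 2 + 4 * (2 * X + 1)) (by simp) fun t => by simp; ring
    · exact hker _ 2 (X ^ 2 + 4 * (2 * X + 1)) (by simp) fun t => by simp; ring
  · rw [hk2, ← Nat.zero_mul N]
    exact hker _ 0 ((X + 1) ^ 4) (by simp) fun t => by simp; ring
  · rw [hk2]; conv_rhs => rw [← Nat.one_mul N]
    exact hker _ 1 (X * (X + 1) ^ 2 + 4 * (2 * X + 2) * (X + 1)) (by simp) fun t => by simp; ring
  · rw [hk2]; conv_rhs => rw [← Nat.one_mul N]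
    exact hker _ 1 (X * (X + 1) ^ 2 + 4 * (2 * X + 2) * (X + 1)) (by simp) fun t => by simp; ring
  · rw [hk2]; conv_rhs => rw [← Nat.one_mul N]
    exact hker _ 1 (X * (X + 1) ^ 2 + 4 * (2 * X + 2) * (X + 1)) (by simp) fun t => by simp; ring
  · rw [hk2]; conv_rhs => rw [← Nat.one_mul N]
    exact hker _ 1 (X * (X + 1) ^ 2 + 4 * (2 * X + 2) * (X + 1)) (by simp) fun t => by simp; ring
  · rw [hk2]; conv_rhs => rw [← Nat.one_mul N]
    exact hker _ 1 (X ^ 3 + 4 * (2 * X + 2) * (2 * X + 2)) (by simp) fun t => by simp; ring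
  · rw [hk3, ← Nat.zero_mul N]
    exact hker _ 0 (X ^ 2 * (X + 1) ^ 2 + 4 * (2 * X + 3) * (2 * X * (X + 1) + 2 * X + 1))
      (by simp) fun t => by simp; ring
  · rw [hk3, ← Nat.zero_mul N]
    exact hker _ 0 (X ^ 2 * (X + 1) ^ 2 + 4 * (2 * X + 3) * (2 * X * (X + 1) + 2 * X + 1))
      (by simp) fun t => by simp; ring

theorem mainTheorem1 :
    IsHyperbolic vamosPoly vamosDir ∧
    hyperbolicityCone vamosPoly vamosDir =
      {v : Fin 4 → ℝ |
        (v 0 • vamosA1 + v 1 • vamosA2 + v 2 • vamosA3 + v 3 • vamosA4).PosSemidef} ∧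
    IsSpectrahedralCone (hyperbolicityCone vamosPoly vamosDir) ∧
    ∀ N : ℕ, 1 ≤ N → ¬ HasDefiniteDetRep (vamosPoly ^ N) vamosDir := by
  exact ⟨vamosPoly_isHyperbolic, hyperbolicityCone_vamosPoly,
    isSpectrahedralCone_hyperbolicityCone_vamosPoly,
    fun _ hN => not_hasDefiniteDetRep_vamosPoly_pow hN⟩
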